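/- For a positive integer $m$ let $\mathrm{OF}_m$ be the monoid (under composition) of all maps $f:[m]\to[m]$, where $[m]=\{1,\dots,m\}$, such that $i\le j$ implies $f(i)\le f(j)$, and $f(m)=m$. For an integer $n\ge 0$ let $\mathrm{IO}_n$ be the monoid (under composition of partial maps) of all partial permutations of $[n]$, i.e. injective partial maps $\theta:[n]\to[n]$, that are order-preserving: $\theta(i)<\theta(j)$ whenever $i<j$ both belong to the domain of $\theta$. For a field $\Bbbk$ and a monoid $S$ let $\Bbbk S$ be the monoid algebra, i.e. the $\Bbbk$-vector space with basis $S$ whose multiplication is the bilinear extension of that of $S$. Proposition. For every field $\Bbbk$ and every integer $n\ge 0$ there is an isomorphism of $\Bbbk$-algebras $$\Bbbk\,\mathrm{OF}_{n+1}\;\simeq\;\Bbbk\,\mathrm{IO}_n .$$ -/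

import Mathlib

namespace OrderMonoids

/-- The monoid of all order-preserving maps `f : [n] → [n]` with `f(n) = n`, for `n ≥ 1`, as a
submonoid of the monoid of all order-preserving maps `[n] → [n]` under composition,
`(f * g)(i) = f(g(i))`. The chain `[n] = {1 < ⋯ < n}` is modelled by `Fin n`,
whose greatest element is `⊤`. -/
def OF (n : ℕ) [NeZero n] : Submonoid (Fin n →o Fin n) where
  carrier := {f | f ⊤ = ⊤}
  one_mem' := rfl
  mul_mem' := by
    intro f g hf hg
    change f (g ⊤) = ⊤
    rw [show g ⊤ = ⊤ from hg]
    exact hf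

/-- The symmetric inverse monoid: partial permutations of `α` under composition of partial maps,
where `θ * τ` means first `τ`, then `θ`. -/
instance symmetricInverseMonoid (α : Type*) : Monoid (α ≃. α) where
  mul θ τ := τ.trans θ
  one := PEquiv.refl α
  mul_assoc a b c := (PEquiv.trans_assoc c b a).symm
  one_mul a := PEquiv.trans_refl a
  mul_one a := PEquiv.refl_trans a

/-- The monoid of all order-preserving partial permutations `θ` of `[n]`: those with
`θ(i) < θ(j)` whenever `i < j` both lie in the domain of `θ`. Here `a ∈ θ i` means that
`θ(i)` is defined and equal to `a`. -/
def POI (n : ℕ) : Submonoid (Fin n ≃. Fin n) where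
  carrier := {θ | ∀ ⦃i j a b : Fin n⦄, a ∈ θ i → b ∈ θ j → i < j → a < b}
  one_mem' := by
    intro i j a b ha hb hij
    have ha' : a ∈ PEquiv.refl (Fin n) i := ha
    have hb' : b ∈ PEquiv.refl (Fin n) j := hb
    simp only [PEquiv.refl_apply, Option.mem_def, Option.some.injEq] at ha' hb'
    rwa [← ha', ← hb']
  mul_mem' := by
    intro θ τ hθ hτ i j a b ha hb hij
    obtain ⟨c, hc, hca⟩ := (PEquiv.mem_trans τ θ i a).1 ha
    obtain ⟨d, hd, hdb⟩ := (PEquiv.mem_trans τ θ j b).1 hb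
    exact hθ hca hdb (hτ hc hd hij)

end OrderMonoids

/-! Dropping the fixed top point turns an element of `OF (n + 1)` into a partial map of `[n]`, so
both monoids act on subsets of `[n]`: `p` takes `S` to `p(S)` if it is defined and injective on `S`,
and to zero otherwise. Both algebras therefore map to the matrices supported on pairs of subsets of
equal size. Each such pair is the (range, domain) of an order-preserving partial permutation `θ`,
and the entry of `p` there is 1 exactly when `p` extends `θ` (`mapsBijectively_iff_isRestriction`).
Both maps are bijective onto these matrices by triangularity. For `POI n` the coordinates form the
zeta matrix of the restriction order. For `OF (n + 1)`, the maps extending `θ` have a greatest one,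
`extend θ`, and `extend` is a bijection from `POI n` to `OF (n + 1)`. -/

namespace OrderMonoids

/-! ### Partial maps acting on subsets -/

/-- A partial map `p` sends the finite set `S` bijectively onto the finite set `T`. -/
def MapsBijectively {α : Type*} [DecidableEq α] (p : α → Option α) (T S : Finset α) : Prop :=
  S.card = T.card ∧ S.image p = T.map Function.Embedding.some

instance {α : Type*} [DecidableEq α] (p : α → Option α) (T S : Finset α) :
    Decidable (MapsBijectively p T S) :=
  inferInstanceAs (Decidable (_ ∧ _))

lemma MapsBijectively.unique {α : Type*} [DecidableEq α] {p : α → Option α} {T T' S : Finset α}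
    (h : MapsBijectively p T S) (h' : MapsBijectively p T' S) : T = T' :=
  Finset.map_injective _ (h.2.symm.trans h'.2)

lemma mapsBijectively_some {α : Type*} [DecidableEq α] {T S : Finset α} :
    MapsBijectively some T S ↔ T = S := by
  constructor
  · rintro ⟨-, h⟩
    refine (Finset.map_injective Function.Embedding.some ?_).symm
    rw [← h, Finset.map_eq_image]
    rfl
  · rintro rfl
    exact ⟨rfl, by rw [Finset.map_eq_image]; rfl⟩

/-- A composite is injective on `S` exactly when `q` is injective on `S` and `p` on `q(S)`; this
makes the action multiplicative. -/
lemma mapsBijectively_bind {α : Type*} [DecidableEq α] {p q : α → Option α} {T S : Finset α} :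
    MapsBijectively (fun i => (q i).bind p) T S ↔
      ∃ U, MapsBijectively p T U ∧ MapsBijectively q U S := by
  constructor
  · rintro ⟨hc, h⟩
    have hnone : none ∉ S.image q := by
      intro hn
      obtain ⟨i, hi, hqi⟩ := Finset.mem_image.1 hn
      have : (q i).bind p ∈ T.map Function.Embedding.some := by
        rw [← h]
        exact Finset.mem_image_of_mem (fun i => (q i).bind p) hi
      simp [hqi] at this
    have hU : S.image q = (Finset.eraseNone (S.image q)).map Function.Embedding.some := by
      rw [Finset.map_some_eraseNone, Finset.erase_eq_of_notMem hnone]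
    set U := Finset.eraseNone (S.image q) with hUdef
    have hUT : U.image p = T.map Function.Embedding.some := by
      rw [← h]
      calc U.image p = (U.map Function.Embedding.some).image (fun o => o.bind p) := by
            rw [Finset.map_eq_image, Finset.image_image]; rfl
        _ = _ := by rw [← hU, Finset.image_image]; rfl
    -- Images cannot grow, so `|T| ≤ |U| ≤ |S| = |T|` forces equality.
    have h1 : U.card ≤ S.card := by
      rw [← Finset.card_map Function.Embedding.some, ← hU]
      exact Finset.card_image_le
    have h2 : T.card ≤ U.card := by
      rw [← Finset.card_map Function.Embedding.some, ← hUT]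
      exact Finset.card_image_le
    exact ⟨U, ⟨by omega, hUT⟩, ⟨by omega, hU⟩⟩
  · rintro ⟨U, ⟨hc, h⟩, ⟨hc', h'⟩⟩
    refine ⟨hc'.trans hc, ?_⟩
    rw [← h]
    calc S.image (fun i => (q i).bind p) = (S.image q).image (fun o => o.bind p) := by
          rw [Finset.image_image]; rfl
      _ = _ := by rw [h', Finset.map_eq_image, Finset.image_image]; rfl

/-- The matrix of the action of a partial map on finite subsets, where a subset on which the map
is not defined or not injective is sent to zero. -/
def subsetMatrix (k : Type*) [Field k] {α : Type*} [DecidableEq α] (p : α → Option α) :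
    Matrix (Finset α) (Finset α) k :=
  fun T S => if MapsBijectively p T S then 1 else 0

lemma subsetMatrix_some (k : Type*) [Field k] {α : Type*} [DecidableEq α] :
    subsetMatrix k (some : α → Option α) = 1 := by
  ext T S
  simp [subsetMatrix, mapsBijectively_some, Matrix.one_apply]

lemma subsetMatrix_bind (k : Type*) [Field k] {α : Type*} [Fintype α] [DecidableEq α]
    (p q : α → Option α) :
    subsetMatrix k (fun i => (q i).bind p) = subsetMatrix k p * subsetMatrix k q := by
  ext T S
  simp only [subsetMatrix, Matrix.mul_apply, mapsBijectively_bind]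
  by_cases h : ∃ U, MapsBijectively p T U ∧ MapsBijectively q U S
  · obtain ⟨U, hp, hq⟩ := h
    rw [if_pos ⟨U, hp, hq⟩, Finset.sum_eq_single U]
    · simp [hp, hq]
    · intro V _ hV
      rw [if_neg (fun h : MapsBijectively q V S => hV (MapsBijectively.unique h hq)), mul_zero]
    · simp
  · rw [if_neg h, Finset.sum_eq_zero]
    intro U _
    by_cases hp : MapsBijectively p T U
    · rw [if_neg (fun hq => h ⟨U, hp, hq⟩), mul_zero]
    · rw [if_neg hp, zero_mul]

/-! ### Order-preserving partial maps and their restrictions -/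

/-- The partial map underlying a map that fixes the top element, which is regarded as the
undefined value. -/
def toPartial {n : ℕ} (f : OF (n + 1)) (i : Fin n) : Option (Fin n) :=
  if h : f.1 i.castSucc = Fin.last n then none else some ((f.1 i.castSucc).castPred h)

lemma mem_toPartial {n : ℕ} {f : OF (n + 1)} {i a : Fin n} :
    a ∈ toPartial f i ↔ f.1 i.castSucc = a.castSucc := by
  unfold toPartial
  split_ifs with h
  · simp [h, (Fin.castSucc_lt_last a).ne']
  · simp only [Option.mem_def, Option.some.injEq]
    constructor
    · rintro rfl; simp
    · intro h'; simp [h']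

lemma map_last {n : ℕ} (f : OF (n + 1)) : f.1 (Fin.last n) = Fin.last n := f.2

lemma toPartial_one {n : ℕ} : toPartial (1 : OF (n + 1)) = some := by
  funext i
  ext a
  rw [← Option.mem_def, mem_toPartial]
  change i.castSucc = a.castSucc ↔ _
  simp

lemma toPartial_mul {n : ℕ} (f g : OF (n + 1)) :
    toPartial (f * g) = fun i => (toPartial g i).bind (toPartial f) := by
  funext i
  ext a
  rw [← Option.mem_def, mem_toPartial, ← Option.mem_def, Option.mem_bind_iff]
  change f.1 (g.1 i.castSucc) = a.castSucc ↔ _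
  simp only [mem_toPartial]
  constructor
  · intro h
    have hg : g.1 i.castSucc ≠ Fin.last n := by
      intro hg
      rw [hg, map_last f] at h
      exact (Fin.castSucc_lt_last a).ne' h
    exact ⟨(g.1 i.castSucc).castPred hg, by simp, by simpa using h⟩
  · rintro ⟨b, hb, h⟩
    rw [hb, h]

/-- Order preservation for partial maps. -/
def IsPartialMono {n : ℕ} (p : Fin n → Option (Fin n)) : Prop :=
  ∀ ⦃i j a b : Fin n⦄, a ∈ p i → b ∈ p j → i ≤ j → a ≤ b

lemma isPartialMono_toPartial {n : ℕ} (f : OF (n + 1)) : IsPartialMono (toPartial f) := by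
  intro i j a b ha hb hij
  rw [mem_toPartial] at ha hb
  rw [← Fin.castSucc_le_castSucc_iff, ← ha, ← hb]
  exact f.1.monotone (Fin.castSucc_le_castSucc_iff.2 hij)

lemma isPartialMono_of_mem_POI {n : ℕ} (θ : POI n) : IsPartialMono θ.1 := by
  intro i j a b ha hb hij
  rcases hij.eq_or_lt with rfl | h
  · exact (Option.mem_unique ha hb).le
  · exact (θ.2 ha hb h).le

/-- The domain of a partial permutation. -/
def domain {n : ℕ} (θ : Fin n ≃. Fin n) : Finset (Fin n) :=
  Finset.univ.filter fun i => (θ i).isSome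

lemma mem_domain {n : ℕ} {θ : Fin n ≃. Fin n} {i : Fin n} : i ∈ domain θ ↔ ∃ a, a ∈ θ i := by
  simp [domain, Option.isSome_iff_exists]

/-- The graph of `θ` is contained in the graph of the partial map `p`. -/
def IsRestriction {n : ℕ} (θ : Fin n ≃. Fin n) (p : Fin n → Option (Fin n)) : Prop :=
  ∀ ⦃i a : Fin n⦄, a ∈ θ i → a ∈ p i

lemma image_domain {n : ℕ} (θ : Fin n ≃. Fin n) :
    (domain θ).image θ = (domain θ.symm).map Function.Embedding.some := by
  ext o
  simp only [Finset.mem_image, Finset.mem_map, mem_domain, PEquiv.mem_iff_mem,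
    Function.Embedding.some_apply]
  constructor
  · rintro ⟨i, ⟨a, ha⟩, rfl⟩
    exact ⟨a, ⟨i, ha⟩, ha.symm⟩
  · rintro ⟨a, ⟨i, hi⟩, rfl⟩
    exact ⟨i, ⟨a, hi⟩, hi⟩

lemma card_domain_symm {n : ℕ} (θ : Fin n ≃. Fin n) :
    (domain θ).card = (domain θ.symm).card := by
  rw [← Finset.card_map (s := domain θ.symm) Function.Embedding.some, ← image_domain,
    Finset.card_image_of_injOn]
  intro i hi j _ hij
  obtain ⟨a, ha⟩ := mem_domain.1 hi
  exact θ.inj ha (by rw [← hij]; exact ha)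

/-- Between two finite subsets of a chain there is at most one increasing bijection, so `p` must
agree with `θ` on the domain. -/
lemma mapsBijectively_iff_isRestriction {n : ℕ} {p : Fin n → Option (Fin n)}
    (hp : IsPartialMono p) (θ : POI n) :
    MapsBijectively p (domain θ.1.symm) (domain θ.1) ↔ IsRestriction θ.1 p := by
  constructor
  · rintro ⟨hc, h⟩
    have hsome : ∀ i : domain θ.1, ∃ a, a ∈ p i := by
      intro i
      have : p i ∈ (domain θ.1.symm).map Function.Embedding.some := by
        rw [← h]; exact Finset.mem_image_of_mem _ i.2
      obtain ⟨a, -, ha⟩ := Finset.mem_map.1 this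
      exact ⟨a, ha.symm⟩
    choose u hu using hsome
    choose v hv using fun i : domain θ.1 => mem_domain.1 i.2
    have hinj : Set.InjOn p (domain θ.1) := by
      rw [← Finset.card_image_iff, h, Finset.card_map, hc]
    have hu_mono : StrictMono u := by
      intro i j hij
      refine lt_of_le_of_ne (hp (hu i) (hu j) hij.le) fun heq => hij.ne ?_
      refine Subtype.ext (hinj i.2 j.2 ?_)
      rw [Option.mem_def.1 (hu i), Option.mem_def.1 (hu j), heq]
    have hv_mono : StrictMono v := fun i j hij => θ.2 (hv i) (hv j) hij
    have hrange : ∀ (w : domain θ.1 → Fin n) (q : Fin n → Option (Fin n)),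
        (∀ i : domain θ.1, w i ∈ q i) →
        (domain θ.1).image q = (domain θ.1.symm).map Function.Embedding.some →
        Set.range w = domain θ.1.symm := by
      intro w q hw hq
      ext a
      have : a ∈ domain θ.1.symm ↔ some a ∈ (domain θ.1).image q := by rw [hq]; simp
      rw [Finset.mem_coe, this, Finset.mem_image]
      constructor
      · rintro ⟨i, rfl⟩
        exact ⟨i, i.2, hw i⟩
      · rintro ⟨i, hi, hqi⟩
        exact ⟨⟨i, hi⟩, Option.mem_unique (hw ⟨i, hi⟩) hqi⟩
    have huv : u = v := (StrictMono.range_inj hu_mono hv_mono).1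
      ((hrange u p hu h).trans (hrange v θ.1 hv (image_domain _)).symm)
    intro i a ha
    have hi : i ∈ domain θ.1 := mem_domain.2 ⟨a, ha⟩
    rw [Option.mem_unique ha (hv ⟨i, hi⟩), ← huv]
    exact hu ⟨i, hi⟩
  · intro h
    refine ⟨card_domain_symm _, ?_⟩
    rw [← image_domain]
    refine Finset.image_congr fun i hi => ?_
    obtain ⟨a, ha⟩ := mem_domain.1 hi
    rw [Option.mem_def.1 ha, Option.mem_def.1 (h ha)]

lemma exists_domain_eq {n : ℕ} {T S : Finset (Fin n)} (h : S.card = T.card) :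
    ∃ θ : POI n, domain θ.1.symm = T ∧ domain θ.1 = S := by
  let e : S ≃o T := (S.orderIsoOfFin rfl).symm.trans (T.orderIsoOfFin h.symm)
  let θ : Fin n ≃. Fin n :=
    { toFun := fun i => if hi : i ∈ S then some (e ⟨i, hi⟩ : Fin n) else none
      invFun := fun a => if ha : a ∈ T then some (e.symm ⟨a, ha⟩ : Fin n) else none
      inv := by
        intro i a
        simp only [Option.dite_none_right_eq_some, Option.some.injEq]
        constructor
        · rintro ⟨ha, rfl⟩
          exact ⟨Subtype.coe_prop _, by simp⟩
        · rintro ⟨hi, rfl⟩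
          exact ⟨Subtype.coe_prop _, by simp⟩ }
  have hθ : ∀ i a, a ∈ θ i ↔ ∃ hi : i ∈ S, (e ⟨i, hi⟩ : Fin n) = a := by
    intro i a
    change (if hi : i ∈ S then some (e ⟨i, hi⟩ : Fin n) else none) = some a ↔ _
    simp
  refine ⟨⟨θ, ?_⟩, ?_, ?_⟩
  · intro i j a b ha hb hij
    obtain ⟨hi, rfl⟩ := (hθ _ _).1 ha
    obtain ⟨hj, rfl⟩ := (hθ _ _).1 hb
    exact e.strictMono (show (⟨i, hi⟩ : S) < ⟨j, hj⟩ from hij)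
  · ext a
    simp only [mem_domain, PEquiv.mem_iff_mem, hθ]
    constructor
    · rintro ⟨i, hi, rfl⟩
      exact Subtype.coe_prop _
    · intro ha
      exact ⟨e.symm ⟨a, ha⟩, Subtype.coe_prop _, by simp⟩
  · ext i
    simp [mem_domain, hθ]

/-! ### The bijection between `POI n` and `OF (n + 1)` -/

/-- The largest map in `OF (n + 1)` that extends `θ`: it sends `i` to the value of `θ` at the
first `j ≥ i` in the domain. -/
def extend {n : ℕ} (θ : POI n) : OF (n + 1) :=
  ⟨{ toFun := fun x => (Finset.univ.filter fun a : Fin n =>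
        ∃ j : Fin n, x ≤ j.castSucc ∧ a ∈ θ.1 j).inf Fin.castSucc
     monotone' := by
      intro x y hxy
      refine Finset.inf_mono fun a ha => ?_
      obtain ⟨j, hj, ha⟩ := (Finset.mem_filter.1 ha).2
      exact Finset.mem_filter.2 ⟨Finset.mem_univ _, j, hxy.trans hj, ha⟩ }, by
    change Finset.inf (Finset.univ.filter fun a : Fin n =>
      ∃ j : Fin n, Fin.last n ≤ j.castSucc ∧ a ∈ θ.1 j) Fin.castSucc = ⊤
    -- No point of `[n]` lies at or above the last one, and the empty infimum is `⊤`.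
    rw [Finset.filter_false_of_mem, Finset.inf_empty]
    rintro a - ⟨j, hj, -⟩
    exact (Fin.castSucc_lt_last j).not_ge hj⟩

lemma le_extend_apply {n : ℕ} {θ : POI n} {x y : Fin (n + 1)} :
    y ≤ (extend θ).1 x ↔ ∀ j a : Fin n, x ≤ j.castSucc → a ∈ θ.1 j → y ≤ a.castSucc := by
  change y ≤ Finset.inf _ _ ↔ _
  rw [Finset.le_inf_iff]
  simp only [Finset.mem_filter, Finset.mem_univ, true_and]
  exact ⟨fun h j a hj ha => h a ⟨j, hj, ha⟩, fun h a ⟨j, hj, ha⟩ => h j a hj ha⟩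

lemma isRestriction_extend {n : ℕ} (θ : POI n) : IsRestriction θ.1 (toPartial (extend θ)) := by
  intro i a ha
  rw [mem_toPartial]
  refine le_antisymm (le_extend_apply.1 le_rfl i a le_rfl ha) ?_
  refine le_extend_apply.2 fun j b hj hb => ?_
  exact Fin.castSucc_le_castSucc_iff.2
    (isPartialMono_of_mem_POI θ ha hb (Fin.castSucc_le_castSucc_iff.1 hj))

lemma le_extend {n : ℕ} {θ : POI n} {g : OF (n + 1)} (h : IsRestriction θ.1 (toPartial g)) :
    g ≤ (extend θ) := by
  intro x
  refine le_extend_apply.2 fun j a hj ha => ?_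
  rw [← mem_toPartial.1 (h ha)]
  exact g.1.monotone hj

/-- An infimum below `⊤` is attained: otherwise `a + 1` would also be a lower bound. -/
lemma exists_of_extend_apply {n : ℕ} {θ : POI n} {x : Fin (n + 1)} {a : Fin n}
    (h : (extend θ).1 x = a.castSucc) : ∃ j : Fin n, x ≤ j.castSucc ∧ a ∈ θ.1 j := by
  by_contra! hcon
  have key : ∀ j b : Fin n, x ≤ j.castSucc → b ∈ θ.1 j → a.succ ≤ b.castSucc := by
    intro j b hj hb
    have h1 : a.castSucc ≤ b.castSucc := le_extend_apply.1 h.ge j b hj hb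
    have h2 : a ≠ b := by
      rintro rfl
      exact hcon j hj hb
    exact Fin.succ_le_castSucc_iff.2 (lt_of_le_of_ne (Fin.castSucc_le_castSucc_iff.1 h1) h2)
  have := le_extend_apply.2 key
  rw [h] at this
  exact (Fin.castSucc_lt_succ (i := a)).not_ge this

/-- Going from `θ` to `τ` and back finds `i ≤ j ≤ l` with `θ i = τ j = θ l = a`; injectivity of `θ`
collapses the chain. -/
lemma le_of_extend_eq {n : ℕ} {θ τ : POI n} (h : extend θ = extend τ) : θ.1 ≤ τ.1 := by
  intro i a ha
  have h1 := mem_toPartial.1 (isRestriction_extend θ ha)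
  rw [h] at h1
  obtain ⟨j, hij, hj⟩ := exists_of_extend_apply h1
  have h2 := mem_toPartial.1 (isRestriction_extend τ hj)
  rw [← h] at h2
  obtain ⟨l, hjl, hl⟩ := exists_of_extend_apply h2
  obtain rfl : i = l := θ.1.inj ha hl
  obtain rfl : i = j := Fin.castSucc_injective _ (le_antisymm hij hjl)
  exact hj

lemma extend_injective {n : ℕ} : Function.Injective (extend (n := n)) := fun _ _ h =>
  Subtype.ext (le_antisymm (le_of_extend_eq h) (le_of_extend_eq h.symm))

lemma max_fiber_eq_iff {n : ℕ} (f : OF (n + 1)) (i a : Fin n) :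
    (Finset.univ.filter fun l : Fin n => a ∈ toPartial f l).max = (i : WithBot (Fin n)) ↔
      (∀ j : Fin n, i < j → f.1 i.castSucc < f.1 j.castSucc) ∧ a ∈ toPartial f i := by
  constructor
  · intro h
    have hi := (Finset.mem_filter.1 (Finset.mem_of_max h)).2
    refine ⟨fun j hij => ?_, hi⟩
    refine lt_of_le_of_ne (f.1.monotone (Fin.castSucc_le_castSucc_iff.2 hij.le)) ?_
    intro heq
    have hj : a ∈ toPartial f j := mem_toPartial.2 (heq.symm.trans (mem_toPartial.1 hi))
    exact hij.not_ge (Finset.le_max_of_eq (Finset.mem_filter.2 ⟨Finset.mem_univ _, hj⟩) h)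
  · rintro ⟨h, hi⟩
    refine le_antisymm ?_ (Finset.le_max (Finset.mem_filter.2 ⟨Finset.mem_univ _, hi⟩))
    refine Finset.max_le fun j hj => WithBot.coe_le_coe.2 ?_
    by_contra! hij
    have h1 := h j hij
    rw [mem_toPartial.1 hi, mem_toPartial.1 (Finset.mem_filter.1 hj).2] at h1
    exact h1.false

/-- The restriction of `f` to the set of the greatest elements of its fibers. -/
def fiberMax {n : ℕ} (f : OF (n + 1)) : Fin n ≃. Fin n where
  toFun i := if ∀ j : Fin n, i < j → f.1 i.castSucc < f.1 j.castSucc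
    then toPartial f i else none
  -- `max` takes values in `WithBot (Fin n)`, that is `Option (Fin n)`; an empty fiber gives an
  -- undefined value.
  invFun a := (Finset.univ.filter fun i : Fin n => a ∈ toPartial f i).max
  inv i a := by
    refine (max_fiber_eq_iff f i a).trans ?_
    simp only [Option.mem_def, Option.ite_none_right_eq_some]

lemma mem_fiberMax {n : ℕ} {f : OF (n + 1)} {i a : Fin n} : a ∈ fiberMax f i ↔
    (∀ j : Fin n, i < j → f.1 i.castSucc < f.1 j.castSucc) ∧ a ∈ toPartial f i := by
  rw [← PEquiv.mem_iff_mem]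
  exact max_fiber_eq_iff f i a

lemma fiberMax_mem_POI {n : ℕ} (f : OF (n + 1)) : fiberMax f ∈ POI n := by
  intro i j a b ha hb hij
  obtain ⟨hi, ha⟩ := mem_fiberMax.1 ha
  have h := hi j hij
  rw [mem_toPartial.1 ha, mem_toPartial.1 (mem_fiberMax.1 hb).2] at h
  exact h

lemma exists_mem_fiberMax {n : ℕ} {f : OF (n + 1)} {i a : Fin n} (h : a ∈ toPartial f i) :
    ∃ j, i ≤ j ∧ a ∈ fiberMax f j := by
  have hi : i ∈ Finset.univ.filter fun l : Fin n => a ∈ toPartial f l :=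
    Finset.mem_filter.2 ⟨Finset.mem_univ i, h⟩
  obtain ⟨j, hj⟩ := Finset.max_of_mem hi
  exact ⟨j, Finset.le_max_of_eq hi hj, mem_fiberMax.2 ((max_fiber_eq_iff f j a).1 hj)⟩

/-- The preimage of `f` is `fiberMax f`: each point with a value below the top lies at or below the
greatest point of its fiber, where that value is kept. -/
lemma extend_surjective {n : ℕ} : Function.Surjective (extend (n := n)) := by
  intro f
  refine ⟨⟨fiberMax f, fiberMax_mem_POI f⟩,
    le_antisymm (fun x => ?_) (le_extend fun i a ha => (mem_fiberMax.1 ha).2)⟩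
  change (extend _).1 x ≤ f.1 x
  rcases Fin.eq_castSucc_or_eq_last x with ⟨i, rfl⟩ | rfl
  swap
  · rw [map_last f]; exact Fin.le_last _
  rcases Fin.eq_castSucc_or_eq_last (f.1 i.castSucc) with ⟨a, ha⟩ | ha
  swap
  · rw [ha]; exact Fin.le_last _
  obtain ⟨j, hij, hja⟩ := exists_mem_fiberMax (mem_toPartial.2 ha)
  rw [ha]
  exact le_extend_apply.1 le_rfl j a (Fin.castSucc_le_castSucc_iff.2 hij) hja

instance {n : ℕ} : Finite (OF (n + 1)) :=
  Finite.of_injective (fun f x => f.1 x) fun _ _ h => Subtype.ext (DFunLike.coe_injective h)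

instance {n : ℕ} : Finite (POI n) :=
  Finite.of_injective _ extend_injective

/-! ### Triangularity and the isomorphism -/

/-- A finite square family of vectors that is triangular with respect to a partial order and has
nonzero diagonal is a basis. -/
lemma bijective_linearCombination_of_triangular {k ι κ : Type*} [Field k] (_ : PartialOrder ι)
    [Finite ι] (v : ι → κ → k) (e : κ ≃ ι) (hdiag : ∀ x, v (e x) x ≠ 0)
    (htri : ∀ x g, v g x ≠ 0 → g ≤ e x) :
    Function.Bijective (Finsupp.linearCombination k v) := by
  have : Fintype ι := Fintype.ofFinite ι
  have : Fintype κ := Fintype.ofEquiv ι e.symm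
  have hinj : Function.Injective (Finsupp.linearCombination k v) := by
    rw [injective_iff_map_eq_zero]
    intro c hc
    by_contra hne
    -- At the coordinate matching a minimal `f` of the support, any contributing `g` satisfies `g ≤
    -- f`, so only `f` survives.
    obtain ⟨f, hf⟩ := c.support.exists_minimal (Finsupp.support_nonempty_iff.2 hne)
    obtain ⟨x, rfl⟩ := e.surjective f
    have hsum := congrFun hc x
    rw [Finsupp.linearCombination_apply, Finsupp.sum, Finset.sum_apply,
      Finset.sum_eq_single (e x)] at hsum
    · exact mul_ne_zero (Finsupp.mem_support_iff.1 hf.1) (hdiag x) hsum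
    · intro g hg hgx
      by_contra h
      have hle := htri x g (right_ne_zero_of_mul h)
      exact hgx (le_antisymm hle (hf.2 hg hle))
    · exact fun h => absurd hf.1 h
  refine ⟨hinj, (LinearMap.injective_iff_surjective_of_finrank_eq_finrank ?_).1 hinj⟩
  simp [Fintype.card_congr e]

/-- The action of `OF (n + 1)` on subsets of `[n]`. -/
def OF.matrixHom (k : Type*) [Field k] (n : ℕ) :
    OF (n + 1) →* Matrix (Finset (Fin n)) (Finset (Fin n)) k where
  toFun f := subsetMatrix k (toPartial f)
  map_one' := by rw [toPartial_one, subsetMatrix_some]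
  map_mul' f g := by rw [toPartial_mul, subsetMatrix_bind]

/-- The action of `POI n` on subsets of `[n]`. -/
def POI.matrixHom (k : Type*) [Field k] (n : ℕ) :
    POI n →* Matrix (Finset (Fin n)) (Finset (Fin n)) k where
  toFun θ := subsetMatrix k θ.1
  map_one' := subsetMatrix_some k
  map_mul' θ τ := subsetMatrix_bind k θ.1 τ.1

/-- The entries of a matrix at the pairs (range, domain) of the elements of `POI n`. -/
def entries (k : Type*) [Field k] (n : ℕ) :
    Matrix (Finset (Fin n)) (Finset (Fin n)) k →ₗ[k] (POI n → k) where
  toFun A θ := A (domain θ.1.symm) (domain θ.1)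
  map_add' _ _ := rfl
  map_smul' _ _ := rfl

lemma entries_subsetMatrix_ne_zero {k : Type*} [Field k] {n : ℕ} {p : Fin n → Option (Fin n)}
    (hp : IsPartialMono p) (θ : POI n) :
    entries k n (subsetMatrix k p) θ ≠ 0 ↔ IsRestriction θ.1 p := by
  rw [← mapsBijectively_iff_isRestriction hp]
  change (if _ then (1 : k) else 0) ≠ 0 ↔ _
  simp

/-- Matrices whose entries vanish at pairs of subsets of different sizes. -/
def cardPreserving (k : Type*) [Field k] (n : ℕ) :
    Submodule k (Matrix (Finset (Fin n)) (Finset (Fin n)) k) where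
  carrier := {A | ∀ T S, S.card ≠ T.card → A T S = 0}
  zero_mem' _ _ _ := rfl
  add_mem' hA hB T S h := by simp [hA T S h, hB T S h]
  smul_mem' c A hA T S h := by simp [hA T S h]

lemma eq_of_entries_eq {k : Type*} [Field k] {n : ℕ}
    {A B : Matrix (Finset (Fin n)) (Finset (Fin n)) k} (hA : A ∈ cardPreserving k n)
    (hB : B ∈ cardPreserving k n) (h : entries k n A = entries k n B) : A = B := by
  ext T S
  by_cases hc : S.card = T.card
  · obtain ⟨θ, rfl, rfl⟩ := exists_domain_eq hc
    exact congrFun h θ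
  · rw [hA T S hc, hB T S hc]

lemma lift_mem_cardPreserving {k M : Type*} [Field k] [Monoid M] {n : ℕ}
    (φ : M →* Matrix (Finset (Fin n)) (Finset (Fin n)) k) (p : M → Fin n → Option (Fin n))
    (hφ : ∀ f, φ f = subsetMatrix k (p f)) (a : MonoidAlgebra k M) :
    MonoidAlgebra.lift k _ M φ a ∈ cardPreserving k n := by
  rw [MonoidAlgebra.lift_apply]
  refine Submodule.sum_mem _ fun f _ => Submodule.smul_mem _ _ fun T S h => ?_
  rw [hφ]
  exact if_neg fun h' => h h'.1

lemma entries_lift {k M : Type*} [Field k] [Monoid M] {n : ℕ}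
    (φ : M →* Matrix (Finset (Fin n)) (Finset (Fin n)) k) (a : MonoidAlgebra k M) :
    entries k n (MonoidAlgebra.lift k _ M φ a) =
      Finsupp.linearCombination k (fun f => entries k n (φ f)) a.coeff := by
  rw [MonoidAlgebra.lift_apply, map_finsuppSum, Finsupp.linearCombination_apply]
  simp only [map_smul]

/-- Two algebra homomorphisms that become bijective after composition with the same map, which is
injective on a set containing both ranges, have isomorphic domains. -/
lemma nonempty_algEquiv_of_bijective_comp {k A B C V : Type*} [CommSemiring k] [Semiring A]
    [Semiring B] [Semiring C] [Algebra k A] [Algebra k B] [Algebra k C] (f : A →ₐ[k] C)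
    (g : B →ₐ[k] C) (π : C → V) (W : Set C) (hf : ∀ a, f a ∈ W) (hg : ∀ b, g b ∈ W)
    (hπ : Set.InjOn π W) (hπf : Function.Bijective (π ∘ f)) (hπg : Function.Bijective (π ∘ g)) :
    Nonempty (A ≃ₐ[k] B) := by
  have hrange : f.range = g.range := by
    ext c
    constructor
    · rintro ⟨a, rfl⟩
      obtain ⟨b, hb⟩ := hπg.2 (π (f a))
      exact ⟨b, hπ (hg b) (hf a) hb⟩
    · rintro ⟨b, rfl⟩
      obtain ⟨a, ha⟩ := hπf.2 (π (g b))
      exact ⟨a, hπ (hf a) (hg b) ha⟩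
  exact ⟨(AlgEquiv.ofInjective f hπf.1.of_comp).trans
    ((Subalgebra.equivOfEq _ _ hrange).trans (AlgEquiv.ofInjective g hπg.1.of_comp).symm)⟩

lemma bijective_entries_lift_OF (k : Type*) [Field k] (n : ℕ) :
    Function.Bijective (entries k n ∘ MonoidAlgebra.lift k _ _ (OF.matrixHom k n)) := by
  rw [show _ ∘ _ = _ from funext (entries_lift (OF.matrixHom k n))]
  refine (bijective_linearCombination_of_triangular inferInstance _
    (Equiv.ofBijective extend ⟨extend_injective, extend_surjective⟩) ?_ ?_).comp
    MonoidAlgebra.coeffEquiv.bijective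
  · intro θ
    exact (entries_subsetMatrix_ne_zero (isPartialMono_toPartial _) θ).2 (isRestriction_extend θ)
  · intro θ f h
    exact le_extend ((entries_subsetMatrix_ne_zero (isPartialMono_toPartial f) θ).1 h)

lemma bijective_entries_lift_POI (k : Type*) [Field k] (n : ℕ) :
    Function.Bijective (entries k n ∘ MonoidAlgebra.lift k _ _ (POI.matrixHom k n)) := by
  rw [show _ ∘ _ = _ from funext (entries_lift (POI.matrixHom k n))]
  refine (bijective_linearCombination_of_triangular
    -- The order is reversed because a nonzero entry of `τ` at `θ` means `θ ≤ τ`.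
    (OrderDual.instPartialOrder (POI n)) _ (Equiv.refl (POI n)) ?_ ?_).comp
    MonoidAlgebra.coeffEquiv.bijective
  · intro θ
    exact (entries_subsetMatrix_ne_zero (isPartialMono_of_mem_POI θ) θ).2 fun _ _ h => h
  · intro θ τ h
    exact (entries_subsetMatrix_ne_zero (isPartialMono_of_mem_POI τ) θ).1 h

end OrderMonoids

open OrderMonoids in
theorem mainTheorem4 (k : Type*) [Field k] (n : ℕ) :
    Nonempty (MonoidAlgebra k (OrderMonoids.OF (n + 1)) ≃ₐ[k]
      MonoidAlgebra k (OrderMonoids.POI n)) :=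
  nonempty_algEquiv_of_bijective_comp (MonoidAlgebra.lift k _ _ (OF.matrixHom k n))
    (MonoidAlgebra.lift k _ _ (POI.matrixHom k n)) (entries k n) (cardPreserving k n)
    (lift_mem_cardPreserving _ toPartial fun _ => rfl)
    (lift_mem_cardPreserving _ (fun θ => θ.1) fun _ => rfl)
    (fun _ hA _ hB h => eq_of_entries_eq hA hB h)
    (bijective_entries_lift_OF k n) (bijective_entries_lift_POI k n)
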